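/- Let $M$ be a smooth ($C^\infty$) real manifold, Hausdorff, finite-dimensional and without boundary. A Poisson tensor on $M$ is a smooth bivector field $\pi$ such that the bracket $\{f,g\}=\pi(df,dg)$ on $C^\infty(M)$ satisfies the Jacobi identity (equivalently, such that the Schouten bracket $[\pi,\pi]$ vanishes); a bivector field $\pi$ is identified with the skew-symmetric bundle map $T^*M\to TM$, $\xi\mapsto\pi(\xi,\cdot)$, and is called nondegenerate if this map is invertible at every point of $M$. Let $U$ and $V$ be Poisson tensors on $M$ such that $U+V$ is nondegenerate. Then the composite bundle map $U(U+V)^{-1}V:T^*M\to TM$ is again a Poisson tensor on $M$; that is, it is smooth and skew-symmetric, and its bracket satisfies the Jacobi identity. -/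

import Mathlib

open scoped Manifold ContDiff

noncomputable section

namespace PoissonTensor

section

variable {E : Type*} [NormedAddCommGroup E] [NormedSpace ℝ E]
  {H : Type*} [TopologicalSpace H] (I : ModelWithCorners ℝ E H)
  {M : Type*} [TopologicalSpace M] [ChartedSpace H M]

/-- The cotangent space `T*ₓM`, the (continuous) dual of the tangent space. It is the fibre at `x`
of the bundle `Hom(TM, M × ℝ)`. -/
abbrev Cotangent (x : M) : Type _ := TangentSpace I x →L[ℝ] Bundle.Trivial M ℝ x

variable (M) in
/-- Families of linear maps `π x : T*ₓM → TₓM`. A contravariant 2-tensor field `π` on `M` is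
identified, as usual, with the bundle map `ξ ↦ π(ξ, ·)` from `T*M` to `TM`. -/
abbrev CotangentToTangent : Type _ := (x : M) → Cotangent I x →L[ℝ] TangentSpace I x

/-- The differential `df` of a real function `f` at `x`, as a covector. -/
def differential (f : M → ℝ) (x : M) : Cotangent I x := mfderiv I 𝓘(ℝ, ℝ) f x

variable {I}

/-- `π` is smooth, as a section of the vector bundle `Hom(T*M, TM)`. -/
def IsSmooth [IsManifold I ∞ M] (π : CotangentToTangent I M) : Prop :=
  ContMDiff I (I.prod 𝓘(ℝ, (E →L[ℝ] ℝ) →L[ℝ] E)) ∞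
    (fun x ↦ Bundle.TotalSpace.mk' ((E →L[ℝ] ℝ) →L[ℝ] E)
      (E := fun x : M ↦ Cotangent I x →L[ℝ] TangentSpace I x) x (π x))

/-- `π` is skew-symmetric: `π(ξ, η) = -π(η, ξ)`, where `π(ξ, η) = ⟨η, π ξ⟩`. -/
def IsSkew (π : CotangentToTangent I M) : Prop :=
  ∀ (x : M) (ξ η : Cotangent I x), η (π x ξ) = -ξ (π x η)

/-- The bracket `{f, g} = π(df, dg)` of real functions on `M`. -/
def bracket (π : CotangentToTangent I M) (f g : M → ℝ) : M → ℝ :=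
  fun x ↦ differential I g x (π x (differential I f x))

/-- `π` is a Poisson tensor: a smooth bivector field whose bracket `{f, g} = π(df, dg)` on smooth
functions satisfies the Jacobi identity. (The cyclic sum below is, up to a nonzero constant factor,
the Schouten bracket `[π, π]` evaluated on `df, dg, dh`.) -/
structure IsPoissonTensor [IsManifold I ∞ M] (π : CotangentToTangent I M) : Prop where
  smooth : IsSmooth π
  skew : IsSkew π
  jacobi : ∀ f g h : M → ℝ, ContMDiff I 𝓘(ℝ, ℝ) ∞ f → ContMDiff I 𝓘(ℝ, ℝ) ∞ g →
    ContMDiff I 𝓘(ℝ, ℝ) ∞ h → ∀ x : M,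
      bracket π (bracket π f g) h x + bracket π (bracket π g h) f x
        + bracket π (bracket π h f) g x = 0

/-- `π` is nondegenerate: `π x : T*ₓM → TₓM` is invertible at every point `x`. -/
def IsNondegenerate (π : CotangentToTangent I M) : Prop := ∀ x : M, (π x).IsInvertible

/-- The bundle map `U (U + V)⁻¹ V : T*M → TM`, meaningful where `U + V` is invertible. -/
def composition (U V : CotangentToTangent I M) : CotangentToTangent I M :=
  fun x ↦ (U x) ∘L (U x + V x).inverse ∘L (V x)

end

end PoissonTensor

end

/-! Write `W = U(U+V)⁻¹V`. Where `U` and `V` are invertible, `W⁻¹ = U⁻¹ + V⁻¹` is a sum of closed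
2-forms, hence closed. The proof replaces this by an identity that needs only `U + V` invertible.
Put `A = (U+V)⁻¹V`, so that `1 - A = (U+V)⁻¹U` and `W = UA = V(1-A)`. Then, up to normalization,
`[W,W](α,β,γ) = [U,U](Aα,Aβ,Aγ) + [V,V]((1-A)α,(1-A)β,(1-A)γ)`, which is
`jacobiator_comp_inverse_comp` in a chart. By `bracket_cyclic_sum` the Jacobi identity at a point
says that the Schouten bracket vanishes on differentials of smooth functions; by
`exists_contMDiff_fderiv_eq` these exhaust the covectors there. -/

noncomputable section

namespace PoissonTensor

open scoped Topology

/-! ### Schouten brackets on a vector space -/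

section VectorSpace

variable {E : Type*} [NormedAddCommGroup E] [NormedSpace ℝ E]

/-- The bracket `{F, G}` of functions on a vector space, for a family of maps `u` from the dual
space to the space. -/
def vectorBracket (u : E → (E →L[ℝ] ℝ) →L[ℝ] E) (F G : E → ℝ) (z : E) : ℝ :=
  fderiv ℝ G z (u z (fderiv ℝ F z))

/-- The Schouten bracket `[u, u]` at the point `y` of a vector space, up to a nonzero constant
factor. -/
def jacobiator (u : E → (E →L[ℝ] ℝ) →L[ℝ] E) (y : E) (α β γ : E →L[ℝ] ℝ) : ℝ :=
  β (fderiv ℝ u y (u y γ) α) + γ (fderiv ℝ u y (u y α) β) + α (fderiv ℝ u y (u y β) γ)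

theorem hasFDerivAt_vectorBracket {u : E → (E →L[ℝ] ℝ) →L[ℝ] E} {y : E}
    (hu : DifferentiableAt ℝ u y) {F G : E → ℝ} (hF : ContDiffAt ℝ 2 F y)
    (hG : ContDiffAt ℝ 2 G y) :
    HasFDerivAt (vectorBracket u F G)
      ((fderiv ℝ G y).comp ((u y).comp (fderiv ℝ (fderiv ℝ F) y)
        + (fderiv ℝ u y).flip (fderiv ℝ F y))
        + (fderiv ℝ (fderiv ℝ G) y).flip (u y (fderiv ℝ F y))) y := by
  have hF' : HasFDerivAt (fderiv ℝ F) (fderiv ℝ (fderiv ℝ F) y) y :=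
    ((hF.fderiv_right (m := 1) (by norm_num)).differentiableAt (by norm_num)).hasFDerivAt
  have hG' : HasFDerivAt (fderiv ℝ G) (fderiv ℝ (fderiv ℝ G) y) y :=
    ((hG.fderiv_right (m := 1) (by norm_num)).differentiableAt (by norm_num)).hasFDerivAt
  exact hG'.clm_apply (hu.hasFDerivAt.clm_apply hF')

theorem vectorBracket_vectorBracket {u : E → (E →L[ℝ] ℝ) →L[ℝ] E} {y : E}
    (hu : DifferentiableAt ℝ u y) (hskew : ∀ ξ η : E →L[ℝ] ℝ, η (u y ξ) = -ξ (u y η))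
    {F G K : E → ℝ} (hF : ContDiffAt ℝ 2 F y) (hG : ContDiffAt ℝ 2 G y) :
    vectorBracket u (vectorBracket u F G) K y =
      fderiv ℝ (fderiv ℝ F) y (u y (fderiv ℝ K y)) (u y (fderiv ℝ G y))
      - fderiv ℝ (fderiv ℝ G) y (u y (fderiv ℝ K y)) (u y (fderiv ℝ F y))
      - fderiv ℝ G y (fderiv ℝ u y (u y (fderiv ℝ K y)) (fderiv ℝ F y)) := by
  rw [vectorBracket, hskew, (hasFDerivAt_vectorBracket hu hF hG).fderiv]
  simp only [add_apply, ContinuousLinearMap.comp_apply,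
    ContinuousLinearMap.flip_apply, map_add]
  rw [hskew _ (fderiv ℝ G y)]
  ring

/-- The Hessian of each function occurs twice with opposite signs and its arguments exchanged, so
symmetry of second derivatives leaves only first differentials. -/
theorem vectorBracket_cyclic_sum {u : E → (E →L[ℝ] ℝ) →L[ℝ] E} {y : E}
    (hu : DifferentiableAt ℝ u y) (hskew : ∀ ξ η : E →L[ℝ] ℝ, η (u y ξ) = -ξ (u y η))
    {F G K : E → ℝ} (hF : ContDiffAt ℝ 2 F y) (hG : ContDiffAt ℝ 2 G y)
    (hK : ContDiffAt ℝ 2 K y) :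
    vectorBracket u (vectorBracket u F G) K y + vectorBracket u (vectorBracket u G K) F y
      + vectorBracket u (vectorBracket u K F) G y =
      -jacobiator u y (fderiv ℝ F y) (fderiv ℝ G y) (fderiv ℝ K y) := by
  rw [vectorBracket_vectorBracket hu hskew hF hG, vectorBracket_vectorBracket hu hskew hG hK,
    vectorBracket_vectorBracket hu hskew hK hF, jacobiator]
  have hs : minSmoothness ℝ 2 ≤ 2 := by simp
  rw [(hF.isSymmSndFDerivAt hs).eq (u y (fderiv ℝ K y)),
    (hG.isSymmSndFDerivAt hs).eq (u y (fderiv ℝ K y)),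
    (hK.isSymmSndFDerivAt hs).eq (u y (fderiv ℝ F y))]
  ring

theorem contDiffAt_inverse_comp {n : ℕ∞ω} {u v : E → (E →L[ℝ] ℝ) →L[ℝ] E} {y : E}
    (hu : ContDiffAt ℝ n u y) (hv : ContDiffAt ℝ n v y) (huv : (u y + v y).IsInvertible) :
    ContDiffAt ℝ n (fun z ↦ (u z + v z).inverse ∘L v z) y := by
  have h : ContDiffAt ℝ n (fun z ↦ (u z + v z).inverse) y :=
    ContDiffAt.comp y (g := ContinuousLinearMap.inverse) huv.contDiffAt_map_inverse (hu.add hv)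
  exact h.clm_comp hv

/-- Differentiating `(u+v)A = v` gives `(u+v)A' = v'(1-A) - u'A`. Skewness gives `γ(uA'β) =
((1-A)γ)((u+v)A'β)`; adding `γ(u'Aβ)` and splitting `γ = Aγ + (1-A)γ` cancels the mixed terms. -/
theorem apply_fderiv_comp_inverse_comp {u v : E → (E →L[ℝ] ℝ) →L[ℝ] E} {y : E}
    (hu : ContDiffAt ℝ 1 u y) (hv : ContDiffAt ℝ 1 v y) (huv : (u y + v y).IsInvertible)
    (hu' : ∀ ξ η : E →L[ℝ] ℝ, η (u y ξ) = -ξ (u y η))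
    (hv' : ∀ ξ η : E →L[ℝ] ℝ, η (v y ξ) = -ξ (v y η)) (X : E) (β γ : E →L[ℝ] ℝ) :
    γ (fderiv ℝ (fun z ↦ u z ∘L (u z + v z).inverse ∘L v z) y X β) =
      (u y + v y).inverse (v y γ) (fderiv ℝ u y X ((u y + v y).inverse (v y β)))
      + (u y + v y).inverse (u y γ) (fderiv ℝ v y X ((u y + v y).inverse (u y β))) := by
  set A : E → (E →L[ℝ] ℝ) →L[ℝ] (E →L[ℝ] ℝ) := fun z ↦ (u z + v z).inverse ∘L v z with hA
  have dA : DifferentiableAt ℝ A y :=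
    (contDiffAt_inverse_comp hu hv huv).differentiableAt (by norm_num)
  have du := hu.differentiableAt (by norm_num)
  have dv := hv.differentiableAt (by norm_num)
  -- Invertibility is an open condition, so `(u+v)A = v` holds near `y` and may be differentiated.
  have hinv : ∀ᶠ z in 𝓝 y, (u z + v z).IsInvertible := by
    obtain ⟨e, he⟩ := huv
    have := ContinuousLinearEquiv.nhds e
    rw [he] at this
    exact (hu.continuousAt.add hv.continuousAt).eventually this
  have hcomp : (fun z ↦ (u z + v z) ∘L A z) =ᶠ[𝓝 y] v := by
    filter_upwards [hinv] with z hz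
    rw [hA, ← ContinuousLinearMap.comp_assoc, hz.self_comp_inverse, ContinuousLinearMap.id_comp]
  have key := ((du.hasFDerivAt.add dv.hasFDerivAt).clm_comp dA.hasFDerivAt).unique
    (dv.hasFDerivAt.congr_of_eventuallyEq hcomp)
  have key' := congr($key X β)
  have hw : HasFDerivAt (fun z ↦ u z ∘L (u z + v z).inverse ∘L v z) _ y :=
    du.hasFDerivAt.clm_comp dA.hasFDerivAt
  rw [hw.fderiv]
  obtain ⟨e, he⟩ := huv
  have he' (ξ) : e ξ = u y ξ + v y ξ := congr($he ξ)
  have hsum (ξ) : e.symm (u y ξ) + e.symm (v y ξ) = ξ := by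
    rw [← map_add, ← he', e.symm_apply_apply]
  simp only [hA, ← he, ContinuousLinearMap.inverse_equiv] at key' ⊢
  simp only [add_apply, Pi.add_apply, ContinuousLinearMap.comp_apply,
    ContinuousLinearMap.compL_apply, ContinuousLinearMap.flip_apply,
    ContinuousLinearEquiv.coe_coe, map_add] at key' ⊢
  rw [← hA] at key' ⊢
  set B := fderiv ℝ A y X β
  set β₁ := e.symm (v y β)
  set β₂ := e.symm (u y β) with hβ₂
  set γ₁ := e.symm (v y γ)
  set γ₂ := e.symm (u y γ) with hγ₂
  have hB : e B = fderiv ℝ v y X β₂ - fderiv ℝ u y X β₁ := by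
    have h := hsum β
    rw [he', ← sub_eq_zero, ← sub_eq_zero.2 key', ← h, map_add]
    abel
  have h1 : γ (u y B) = γ₂ (e B) := by
    rw [hu' B γ, show u y γ = e γ₂ by rw [hγ₂, e.apply_symm_apply], he', he', map_add, map_add,
      hu' B γ₂, hv' B γ₂]
    ring
  rw [h1, hB, ← hsum γ]
  simp only [map_sub, add_apply]
  ring

/-- The direction of differentiation `Wγ` is read as `u(Aγ)` in the `u'` terms and as `v((1-A)γ)` in
the `v'` terms. -/
theorem jacobiator_comp_inverse_comp {u v : E → (E →L[ℝ] ℝ) →L[ℝ] E} {y : E}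
    (hu : ContDiffAt ℝ 1 u y) (hv : ContDiffAt ℝ 1 v y) (huv : (u y + v y).IsInvertible)
    (hu' : ∀ ξ η : E →L[ℝ] ℝ, η (u y ξ) = -ξ (u y η))
    (hv' : ∀ ξ η : E →L[ℝ] ℝ, η (v y ξ) = -ξ (v y η)) (α β γ : E →L[ℝ] ℝ) :
    jacobiator (fun z ↦ u z ∘L (u z + v z).inverse ∘L v z) y α β γ =
      jacobiator u y ((u y + v y).inverse (v y α)) ((u y + v y).inverse (v y β))
        ((u y + v y).inverse (v y γ))
      + jacobiator v y ((u y + v y).inverse (u y α)) ((u y + v y).inverse (u y β))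
        ((u y + v y).inverse (u y γ)) := by
  have h (ξ : E →L[ℝ] ℝ) :
      v y ((u y + v y).inverse (u y ξ)) = u y ((u y + v y).inverse (v y ξ)) := by
    obtain ⟨e, he⟩ := huv
    have he' (ξ) : e ξ = u y ξ + v y ξ := congr($he ξ)
    rw [← he, ContinuousLinearMap.inverse_equiv, ContinuousLinearEquiv.coe_coe]
    have h1 : e.symm (u y ξ) = ξ - e.symm (v y ξ) := by
      rw [eq_sub_iff_add_eq, ← map_add, ← he', e.symm_apply_apply]
    rw [h1, map_sub, sub_eq_iff_eq_add, ← he', e.apply_symm_apply]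
  simp only [jacobiator, apply_fderiv_comp_inverse_comp hu hv huv hu' hv',
    ContinuousLinearMap.comp_apply, h]
  ring

end VectorSpace

/-! ### Smoothness, skew-symmetry and trivializations -/

section Manifold

variable {E : Type*} [NormedAddCommGroup E] [NormedSpace ℝ E]
  {H : Type*} [TopologicalSpace H] {I : ModelWithCorners ℝ E H}
  {M : Type*} [TopologicalSpace M] [ChartedSpace H M]

/-- Transposing gives `-V(U+V)⁻¹U`, and `V(U+V)⁻¹U = U - U(U+V)⁻¹U = U(U+V)⁻¹V`. -/
theorem isSkew_composition {U V : CotangentToTangent I M} (hU : IsSkew U) (hV : IsSkew V)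
    (hUV : IsNondegenerate (U + V)) : IsSkew (composition U V) := by
  intro x ξ η
  obtain ⟨e, he⟩ := hUV x
  have he' (ζ) : e ζ = U x ζ + V x ζ := congr($he ζ)
  have hskew (ζ θ : Cotangent I x) : θ (e ζ) = -ζ (e θ) := by
    rw [he', he', map_add, map_add, hU x ζ θ, hV x ζ θ]
    exact (neg_add _ _).symm
  have hadd : U x + V x = e := he.symm
  have hcomp (ζ : Cotangent I x) : composition U V x ζ = U x (e.symm (V x ζ)) := by
    simp [composition, hadd]
  have hcomm (ζ : Cotangent I x) : V x (e.symm (U x ζ)) = U x (e.symm (V x ζ)) := by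
    have h1 : e.symm (U x ζ) = ζ - e.symm (V x ζ) := by
      rw [eq_sub_iff_add_eq, ← map_add, ← he', e.symm_apply_apply]
    rw [h1, map_sub, sub_eq_iff_eq_add, ← he', e.apply_symm_apply]
  calc η (composition U V x ξ) = -e.symm (V x ξ) (e (e.symm (U x η))) := by
        rw [hcomp, hU x _ η, e.apply_symm_apply]
    _ = e.symm (U x η) (V x ξ) := by
        rw [hskew, e.apply_symm_apply]
        exact neg_neg _
    _ = -ξ (composition U V x η) := by rw [hV x ξ, hcomm, hcomp]

variable [IsManifold I ∞ M]

/-- The value at `p` of a family of maps from the cotangent to the tangent spaces, in the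
trivializations centred at `x`. -/
def inTrivialization (π : CotangentToTangent I M) (x p : M) : (E →L[ℝ] ℝ) →L[ℝ] E :=
  ContinuousLinearMap.inCoordinates (E →L[ℝ] ℝ) (fun x : M ↦ Cotangent I x) E
    (fun x : M ↦ TangentSpace I x) x p x p (π p)

/-- The trivialization at `x` of the tangent bundle, on the fibre at `p`. -/
def tangentEquiv (x : M) {p : M} (hp : p ∈ (chartAt H x).source) : TangentSpace I p ≃L[ℝ] E :=
  (trivializationAt E (TangentSpace I) x).continuousLinearEquivAt ℝ p (by simpa using hp)

theorem coe_tangentEquiv (x : M) {p : M} (hp : p ∈ (chartAt H x).source) :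
    (tangentEquiv (I := I) x hp : TangentSpace I p →L[ℝ] E)
      = mfderiv I 𝓘(ℝ, E) (extChartAt I x) p := by
  rw [← TangentBundle.continuousLinearMapAt_trivializationAt hp]
  exact Bundle.Trivialization.coe_continuousLinearEquivAt_eq' _ _

/-- The trivialization at `x` of the cotangent bundle, on the fibre at `p`. -/
def cotangentEquiv (x : M) {p : M} (hp : p ∈ (chartAt H x).source) :
    Cotangent I p ≃L[ℝ] (E →L[ℝ] ℝ) :=
  (tangentEquiv (I := I) x hp).arrowCongr (.refl ℝ ℝ)

theorem cotangentEquiv_symm_apply (x : M) {p : M} (hp : p ∈ (chartAt H x).source)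
    (ξ : E →L[ℝ] ℝ) (v : TangentSpace I p) :
    (cotangentEquiv x hp).symm ξ v = ξ (tangentEquiv x hp v) :=
  rfl

theorem continuousLinearEquivAt_cotangent (x : M) {p : M} (hp : p ∈ (chartAt H x).source)
    (hp' : p ∈ (trivializationAt (E →L[ℝ] ℝ) (fun x : M ↦ Cotangent I x) x).baseSet) :
    (trivializationAt (E →L[ℝ] ℝ) (fun x : M ↦ Cotangent I x) x).continuousLinearEquivAt ℝ p hp' =
      cotangentEquiv x hp := by
  ext η v
  change (trivializationAt ℝ (Bundle.Trivial M ℝ) x).continuousLinearMapAt ℝ p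
    (η ((trivializationAt E (TangentSpace I) x).symmL ℝ p v)) =
    η ((tangentEquiv (I := I) x hp).symm v)
  rw [tangentEquiv, Bundle.Trivialization.symm_continuousLinearEquivAt_eq]
  simp

/-- Over the chart domain the coordinate form is a composition with genuine equivalences, through
which inverses and skewness pass. -/
theorem inTrivialization_eq (π : CotangentToTangent I M) (x : M) {p : M}
    (hp : p ∈ (chartAt H x).source) :
    inTrivialization π x p =
      (tangentEquiv (I := I) x hp : TangentSpace I p →L[ℝ] E) ∘L π p ∘L
        ((cotangentEquiv (I := I) x hp).symm : (E →L[ℝ] ℝ) →L[ℝ] Cotangent I p) := by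
  have hp' : p ∈ (trivializationAt (E →L[ℝ] ℝ) (fun x : M ↦ Cotangent I x) x).baseSet := by
    simpa using hp
  have hp'' : p ∈ (trivializationAt E (TangentSpace I) x).baseSet := by simpa using hp
  rw [inTrivialization, ContinuousLinearMap.inCoordinates,
    ← Bundle.Trivialization.coe_continuousLinearEquivAt_eq' _ hp'',
    ← Bundle.Trivialization.symm_continuousLinearEquivAt_eq' _ hp',
    continuousLinearEquivAt_cotangent x hp, tangentEquiv]

theorem isSmooth_iff {π : CotangentToTangent I M} :
    IsSmooth π ↔ ∀ x : M, ContMDiffAt I 𝓘(ℝ, (E →L[ℝ] ℝ) →L[ℝ] E) ∞ (inTrivialization π x) x :=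
  forall_congr' fun _ ↦ (contMDiffAt_hom_bundle _).trans (and_iff_right contMDiffAt_id)

theorem inTrivialization_composition (U V : CotangentToTangent I M) (x : M) {p : M}
    (hp : p ∈ (chartAt H x).source) :
    inTrivialization (composition U V) x p =
      inTrivialization U x p ∘L (inTrivialization U x p + inTrivialization V x p).inverse
        ∘L inTrivialization V x p := by
  have h : inTrivialization U x p + inTrivialization V x p =
      (tangentEquiv (I := I) x hp : TangentSpace I p →L[ℝ] E) ∘L (U p + V p) ∘L
        ((cotangentEquiv (I := I) x hp).symm : (E →L[ℝ] ℝ) →L[ℝ] Cotangent I p) := by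
    simp [inTrivialization_eq _ x hp, ContinuousLinearMap.comp_add, ContinuousLinearMap.add_comp]
  rw [h, inTrivialization_eq _ x hp, inTrivialization_eq U x hp, inTrivialization_eq V x hp]
  rw [ContinuousLinearMap.inverse_equiv_comp, ContinuousLinearMap.inverse_comp_equiv]
  ext ξ
  simp [composition]

theorem isInvertible_inTrivialization_add {U V : CotangentToTangent I M}
    (hUV : IsNondegenerate (U + V)) (x : M) {p : M} (hp : p ∈ (chartAt H x).source) :
    (inTrivialization U x p + inTrivialization V x p).IsInvertible := by
  have h : inTrivialization U x p + inTrivialization V x p = inTrivialization (U + V) x p := by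
    simp [inTrivialization_eq _ x hp, ContinuousLinearMap.comp_add, ContinuousLinearMap.add_comp]
  rw [h, inTrivialization_eq _ x hp]
  rw [ContinuousLinearMap.isInvertible_equiv_comp, ContinuousLinearMap.isInvertible_comp_equiv]
  exact hUV p

theorem IsSkew.inTrivialization {π : CotangentToTangent I M} (hπ : IsSkew π) (x : M) {p : M}
    (hp : p ∈ (chartAt H x).source) (ξ η : E →L[ℝ] ℝ) :
    η (inTrivialization π x p ξ) = -ξ (inTrivialization π x p η) := by
  simpa [inTrivialization_eq π x hp, cotangentEquiv_symm_apply] using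
    hπ p ((cotangentEquiv x hp).symm ξ) ((cotangentEquiv x hp).symm η)

theorem isSmooth_composition {U V : CotangentToTangent I M} (hU : IsSmooth U) (hV : IsSmooth V)
    (hUV : IsNondegenerate (U + V)) : IsSmooth (composition U V) := by
  rw [isSmooth_iff] at hU hV ⊢
  intro x
  have hinv : ContMDiffAt I 𝓘(ℝ, E →L[ℝ] (E →L[ℝ] ℝ)) ∞
      (fun p ↦ (inTrivialization U x p + inTrivialization V x p).inverse) x :=
    ContDiffAt.comp_contMDiffAt (g := ContinuousLinearMap.inverse)
      (isInvertible_inTrivialization_add hUV x (mem_chart_source H x)).contDiffAt_map_inverse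
      ((hU x).add (hV x))
  refine ((hU x).clm_comp (hinv.clm_comp (hV x))).congr_of_eventuallyEq ?_
  filter_upwards [(chartAt H x).open_source.mem_nhds (mem_chart_source H x)] with p hp
  exact inTrivialization_composition U V x hp

end Manifold

/-! ### The Jacobi identity in charts -/

section Chart

variable {E : Type*} [NormedAddCommGroup E] [NormedSpace ℝ E]
  {H : Type*} [TopologicalSpace H] {I : ModelWithCorners ℝ E H}
  {M : Type*} [TopologicalSpace M] [ChartedSpace H M]

theorem eventuallyEq_comp_extChartAt (f : M → ℝ) (x : M) :
    f =ᶠ[𝓝 x] (f ∘ (extChartAt I x).symm) ∘ extChartAt I x := by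
  filter_upwards [extChartAt_source_mem_nhds (I := I) x] with p hp
  exact congrArg f ((extChartAt I x).left_inv hp).symm

theorem contDiffAt_comp_extChartAt_symm [I.Boundaryless] {F : Type*} [NormedAddCommGroup F] [NormedSpace ℝ F]
    {f : M → F} {x : M} (hf : ContMDiffAt I 𝓘(ℝ, F) ∞ f x) :
    ContDiffAt ℝ ∞ (f ∘ (extChartAt I x).symm) (extChartAt I x x) := by
  have h := (contMDiffAt_iff.1 hf).2
  rwa [I.range_eq_univ, contDiffWithinAt_univ] at h

variable [IsManifold I ∞ M]

/-- A family of maps from the cotangent to the tangent spaces, read in the chart at `x`. -/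
def inChart (π : CotangentToTangent I M) (x : M) (y : E) : (E →L[ℝ] ℝ) →L[ℝ] E :=
  inTrivialization π x ((extChartAt I x).symm y)

theorem differential_eq_of_eventuallyEq {f : M → ℝ} {F : E → ℝ} {x p : M}
    (hp : p ∈ (chartAt H x).source) (hF : DifferentiableAt ℝ F (extChartAt I x p))
    (hf : f =ᶠ[𝓝 p] F ∘ extChartAt I x) :
    differential I f p = (cotangentEquiv x hp).symm (fderiv ℝ F (extChartAt I x p)) := by
  have h : HasMFDerivAt I 𝓘(ℝ, ℝ) f p ((fderiv ℝ F (extChartAt I x p)).comp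
      (mfderiv I 𝓘(ℝ, E) (extChartAt I x) p)) :=
    (hF.hasFDerivAt.hasMFDerivAt.comp p
      (mdifferentiableAt_extChartAt hp).hasMFDerivAt).congr_of_eventuallyEq hf
  rw [differential, h.mfderiv, ← coe_tangentEquiv x hp]
  rfl

theorem bracket_eq_vectorBracket (π : CotangentToTangent I M) {f g : M → ℝ} {F G : E → ℝ} {x p : M}
    (hp : p ∈ (chartAt H x).source) (hF : DifferentiableAt ℝ F (extChartAt I x p))
    (hG : DifferentiableAt ℝ G (extChartAt I x p))
    (hf : f =ᶠ[𝓝 p] F ∘ extChartAt I x) (hg : g =ᶠ[𝓝 p] G ∘ extChartAt I x) :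
    bracket π f g p = vectorBracket (inChart π x) F G (extChartAt I x p) := by
  rw [bracket, differential_eq_of_eventuallyEq hp hF hf, differential_eq_of_eventuallyEq hp hG hg,
    vectorBracket, inChart, (extChartAt I x).left_inv (by simpa using hp),
    inTrivialization_eq π x hp]
  rfl

/-- Equality on a neighbourhood is needed because the outer bracket differentiates the inner one. -/
theorem bracket_eventuallyEq_vectorBracket (π : CotangentToTangent I M) {f g : M → ℝ}
    {F G : E → ℝ} {x : M} (hF : ContDiffAt ℝ 2 F (extChartAt I x x))
    (hG : ContDiffAt ℝ 2 G (extChartAt I x x))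
    (hf : f =ᶠ[𝓝 x] F ∘ extChartAt I x) (hg : g =ᶠ[𝓝 x] G ∘ extChartAt I x) :
    bracket π f g =ᶠ[𝓝 x] vectorBracket (inChart π x) F G ∘ extChartAt I x := by
  have hd {K : E → ℝ} (hK : ContDiffAt ℝ 2 K (extChartAt I x x)) :
      ∀ᶠ p in 𝓝 x, DifferentiableAt ℝ K (extChartAt I x p) :=
    (continuousAt_extChartAt x).eventually
      ((hK.eventually (by simp)).mono fun _ h ↦ h.differentiableAt (by norm_num))
  filter_upwards [(chartAt H x).open_source.mem_nhds (mem_chart_source H x), hd hF, hd hG,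
    hf.eventually_nhds, hg.eventually_nhds] with p hp hFp hGp hfp hgp
  exact bracket_eq_vectorBracket π hp hFp hGp hfp hgp

variable [I.Boundaryless]

theorem bracket_cyclic_sum {π : CotangentToTangent I M} (hπ : IsSmooth π) (hskew : IsSkew π)
    {f g h : M → ℝ} (hf : ContMDiff I 𝓘(ℝ, ℝ) ∞ f) (hg : ContMDiff I 𝓘(ℝ, ℝ) ∞ g)
    (hh : ContMDiff I 𝓘(ℝ, ℝ) ∞ h) (x : M) :
    bracket π (bracket π f g) h x + bracket π (bracket π g h) f x
      + bracket π (bracket π h f) g x =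
    -jacobiator (inChart π x) (extChartAt I x x)
      (fderiv ℝ (f ∘ (extChartAt I x).symm) (extChartAt I x x))
      (fderiv ℝ (g ∘ (extChartAt I x).symm) (extChartAt I x x))
      (fderiv ℝ (h ∘ (extChartAt I x).symm) (extChartAt I x x)) := by
  have hu : DifferentiableAt ℝ (inChart π x) (extChartAt I x x) :=
    (contDiffAt_comp_extChartAt_symm (isSmooth_iff.1 hπ x)).differentiableAt (by simp)
  have hC {f : M → ℝ} (hf : ContMDiff I 𝓘(ℝ, ℝ) ∞ f) :
      ContDiffAt ℝ 2 (f ∘ (extChartAt I x).symm) (extChartAt I x x) :=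
    (contDiffAt_comp_extChartAt_symm (hf x)).of_le (WithTop.coe_le_coe.2 le_top)
  have key {f g h : M → ℝ} (hf : ContMDiff I 𝓘(ℝ, ℝ) ∞ f) (hg : ContMDiff I 𝓘(ℝ, ℝ) ∞ g)
      (hh : ContMDiff I 𝓘(ℝ, ℝ) ∞ h) :
      bracket π (bracket π f g) h x =
        vectorBracket (inChart π x) (vectorBracket (inChart π x) (f ∘ (extChartAt I x).symm)
          (g ∘ (extChartAt I x).symm)) (h ∘ (extChartAt I x).symm) (extChartAt I x x) :=
    bracket_eq_vectorBracket π (mem_chart_source H x)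
      (hasFDerivAt_vectorBracket hu (hC hf) (hC hg)).differentiableAt
      ((hC hh).differentiableAt (by simp))
      (bracket_eventuallyEq_vectorBracket π (hC hf) (hC hg) (eventuallyEq_comp_extChartAt f x)
        (eventuallyEq_comp_extChartAt g x))
      (eventuallyEq_comp_extChartAt h x)
  rw [key hf hg hh, key hg hh hf, key hh hf hg]
  refine vectorBracket_cyclic_sum hu (fun ξ η ↦ ?_) (hC hf) (hC hg) (hC hh)
  rw [inChart, extChartAt_to_inv]
  exact hskew.inTrivialization x (mem_chart_source H x) ξ η

variable [FiniteDimensional ℝ E] [T2Space M]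

/-- The Jacobi hypothesis concerns global functions, so the linear function `ξ` of the chart is cut
off by a bump function equal to 1 near `x`. -/
theorem exists_contMDiff_fderiv_eq (x : M) (ξ : E →L[ℝ] ℝ) :
    ∃ f : M → ℝ, ContMDiff I 𝓘(ℝ, ℝ) ∞ f ∧
      fderiv ℝ (f ∘ (extChartAt I x).symm) (extChartAt I x x) = ξ := by
  let b : SmoothBumpFunction I x := Classical.arbitrary _
  refine ⟨fun p ↦ b p • ξ (extChartAt I x p), b.contMDiff_smul ?_, ?_⟩
  · exact ξ.contMDiff.comp_contMDiffOn contMDiffOn_extChartAt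
  · have h : (fun p ↦ b p • ξ (extChartAt I x p)) ∘ (extChartAt I x).symm
        =ᶠ[𝓝 (extChartAt I x x)] ξ := by
      have hc : Filter.Tendsto (extChartAt I x).symm (𝓝 (extChartAt I x x)) (𝓝 x) := by
        simpa [ContinuousAt] using continuousAt_extChartAt_symm (I := I) x
      filter_upwards [hc.eventually b.eventuallyEq_one, extChartAt_target_mem_nhds (I := I) x]
        with y hy hy'
      simp only [Function.comp_apply, hy, (extChartAt I x).right_inv hy', Pi.one_apply, one_smul]
    rw [h.fderiv_eq, ξ.fderiv]

theorem IsPoissonTensor.jacobiator_eq_zero {π : CotangentToTangent I M} (hπ : IsPoissonTensor π)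
    (x : M) (α β γ : E →L[ℝ] ℝ) :
    jacobiator (inChart π x) (extChartAt I x x) α β γ = 0 := by
  obtain ⟨f, hf, rfl⟩ := exists_contMDiff_fderiv_eq (I := I) x α
  obtain ⟨g, hg, rfl⟩ := exists_contMDiff_fderiv_eq (I := I) x β
  obtain ⟨h, hh, rfl⟩ := exists_contMDiff_fderiv_eq (I := I) x γ
  rw [← neg_eq_zero, ← bracket_cyclic_sum hπ.smooth hπ.skew hf hg hh x]
  exact hπ.jacobi f g h hf hg hh x

/-- Vanishing at the centre of each chart suffices, since the Jacobi identity at `x` is read in the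
chart at `x`. -/
theorem jacobiator_composition {U V : CotangentToTangent I M} (hU : IsPoissonTensor U)
    (hV : IsPoissonTensor V) (hUV : IsNondegenerate (U + V)) (x : M) (α β γ : E →L[ℝ] ℝ) :
    jacobiator (inChart (composition U V) x) (extChartAt I x x) α β γ = 0 := by
  have h : inChart (composition U V) x =ᶠ[𝓝 (extChartAt I x x)]
      fun y ↦ inChart U x y ∘L (inChart U x y + inChart V x y).inverse ∘L inChart V x y := by
    filter_upwards [extChartAt_target_mem_nhds (I := I) x] with y hy
    exact inTrivialization_composition U V x (by simpa using (extChartAt I x).map_target hy)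
  have hC {π : CotangentToTangent I M} (hπ : IsPoissonTensor π) :
      ContDiffAt ℝ 1 (inChart π x) (extChartAt I x x) :=
    (contDiffAt_comp_extChartAt_symm (isSmooth_iff.1 hπ.smooth x)).of_le
      (by exact_mod_cast le_top)
  have hskew {π : CotangentToTangent I M} (hπ : IsPoissonTensor π) (ξ η : E →L[ℝ] ℝ) :
      η (inChart π x (extChartAt I x x) ξ) = -ξ (inChart π x (extChartAt I x x) η) := by
    rw [inChart, extChartAt_to_inv]
    exact hπ.skew.inTrivialization x (mem_chart_source H x) ξ η
  have hinv : (inChart U x (extChartAt I x x) + inChart V x (extChartAt I x x)).IsInvertible := by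
    rw [inChart, inChart, extChartAt_to_inv]
    exact isInvertible_inTrivialization_add hUV x (mem_chart_source H x)
  rw [jacobiator, h.fderiv_eq, h.eq_of_nhds]
  refine (jacobiator_comp_inverse_comp (hC hU) (hC hV) hinv (hskew hU) (hskew hV) α β γ).trans ?_
  rw [hU.jacobiator_eq_zero, hV.jacobiator_eq_zero, add_zero]

end Chart

end PoissonTensor

end

theorem corollary6p7
    {E : Type*} [NormedAddCommGroup E] [NormedSpace ℝ E] [FiniteDimensional ℝ E]
    {H : Type*} [TopologicalSpace H] {I : ModelWithCorners ℝ E H} [I.Boundaryless]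
    {M : Type*} [TopologicalSpace M] [T2Space M] [ChartedSpace H M] [IsManifold I ∞ M]
    (U V : PoissonTensor.CotangentToTangent I M)
    (hU : PoissonTensor.IsPoissonTensor U) (hV : PoissonTensor.IsPoissonTensor V)
    (hUV : PoissonTensor.IsNondegenerate (U + V)) :
    PoissonTensor.IsPoissonTensor (PoissonTensor.composition U V) := by
  have hsmooth := PoissonTensor.isSmooth_composition hU.smooth hV.smooth hUV
  have hskew := PoissonTensor.isSkew_composition hU.skew hV.skew hUV
  refine ⟨hsmooth, hskew, fun f g h hf hg hh x ↦ ?_⟩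
  rw [PoissonTensor.bracket_cyclic_sum hsmooth hskew hf hg hh x,
    PoissonTensor.jacobiator_composition hU hV hUV, neg_zero]
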